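/- **Proposition (Characterisation of the Boundary).** Let $\tau\in\mathbb{C}$ satisfy $\tau^2-p\tau+q=0$ with $p,q\in\mathbb{Z}$ and $4q-p^2>0$, suppose $|\tau|>1$, and let $w\ge 2$ be an integer. Let $V=\{z\in\mathbb{C} : |z|\le|z-y| \text{ for all } y\in\mathbb{Z}[\tau]\}$ be the Voronoi cell of $0$ for the lattice $\mathbb{Z}[\tau]$. Let $\mathcal{D}\subseteq\mathbb{Z}[\tau]$ be a minimal norm representatives digit set modulo $\tau^w$, that is, $\mathcal{D}$ consists of $0$ and of exactly one representative of each residue class of $\mathbb{Z}[\tau]$ modulo $\tau^w$ that is not divisible by $\tau$, and each non-zero $\eta\in\mathcal{D}$ lies in $\tau^w V$ (equivalently, has minimal absolute value in its residue class modulo $\tau^w$; if several elements of a class have minimal absolute value, any one of them may be chosen). A *$w$-NAF* is a sequence $\boldsymbol{\xi}=(\xi_j)_{j\in\mathbb{Z}}\in\mathcal{D}^{\mathbb{Z}}$ such that among any $w$ consecutive digits $\xi_{j+w-1},\dots,\xi_j$ at most one is non-zero. If $\xi_j=0$ for all sufficiently large $j$, its value is $\operatorname{value}(\boldsymbol{\xi})=\sum_{j\in\mathbb{Z}}\xi_j\tau^j$,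 and its integer part is $\boldsymbol{\xi}_I=(\xi_j)_{j\ge 0}$. Let $$\mathcal{F}=\{\operatorname{value}(\boldsymbol{\xi}) : \boldsymbol{\xi}\text{ is a } w\text{-NAF with } \xi_j=0 \text{ for all } j\ge 0\}$$ be the fundamental domain, and let $z\in\mathcal{F}$. Then $z$ lies on the topological boundary $\partial\mathcal{F}$ of $\mathcal{F}$ in $\mathbb{C}$ if and only if there is a $w$-NAF $\boldsymbol{\xi}$ with $\xi_j=0$ for all sufficiently large $j$ and with integer part $\boldsymbol{\xi}_I\ne\boldsymbol{0}$ such that $z=\operatorname{value}(\boldsymbol{\xi})$. -/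

import Mathlib

namespace WNaf

/-- The ring `ℤ[τ] ⊆ ℂ`. -/
abbrev Ztau (τ : ℂ) : Subalgebra ℤ ℂ := Algebra.adjoin ℤ {τ}

/-- `τ` as an element of `ℤ[τ]`. -/
def base (τ : ℂ) : Ztau τ := ⟨τ, Algebra.subset_adjoin (Set.mem_singleton τ)⟩

/-- The (closed) Voronoi cell of `0` for the lattice `ℤ[τ]`. -/
def voronoiCell (τ : ℂ) : Set ℂ := {z | ∀ y : Ztau τ, ‖z‖ ≤ ‖z - (y : ℂ)‖}

/-- A reduced residue digit set modulo `τ ^ w`: it consists of `0` and exactly one representative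
of each residue class of `ℤ[τ]` modulo `τ ^ w` that is not divisible by `τ`. Divisibility is
divisibility in `ℤ[τ]`. -/
structure IsReducedResidueDigitSet (τ : ℂ) (w : ℕ) (D : Set (Ztau τ)) : Prop where
  zero_mem : 0 ∈ D
  not_dvd : ∀ η ∈ D, η ≠ 0 → ¬ base τ ∣ η
  existsUnique : ∀ x : Ztau τ, ¬ base τ ∣ x → ∃! η : Ztau τ, η ∈ D ∧ base τ ^ w ∣ x - η

/-- `η` is not divisible by `τ` and lies in the scaled Voronoi cell `τ ^ w V`, that is, `η` has
minimal absolute value in its residue class modulo `τ ^ w`. If a class has several elements of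
minimal absolute value (they then lie on the boundary of `τ ^ w V`), each of them qualifies. -/
def IsMinNormRep (τ : ℂ) (w : ℕ) (η : Ztau τ) : Prop :=
  ¬ base τ ∣ η ∧ (η : ℂ) ∈ (fun z : ℂ => τ ^ w * z) '' voronoiCell τ

/-- A minimal norm representatives digit set modulo `τ ^ w`; ties within a residue class may be
broken in any way, so in particular by a fixed rule that selects a part of the boundary of the
Voronoi cell. -/
structure IsMinNormDigitSet (τ : ℂ) (w : ℕ) (D : Set (Ztau τ)) : Prop
    extends IsReducedResidueDigitSet τ w D where
  minNorm : ∀ η ∈ D, η ≠ 0 → IsMinNormRep τ w η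

/-- A bi-infinite sequence of digits in `D` is a width-`w` non-adjacent form if each block of
`w` consecutive digits contains at most one non-zero digit. -/
structure IsWNaf {τ : ℂ} (w : ℕ) (D : Set (Ztau τ)) (ξ : ℤ → Ztau τ) : Prop where
  mem : ∀ j, ξ j ∈ D
  nonadjacent : ∀ j : ℤ, {i : ℤ | i ∈ Set.Ico j (j + w) ∧ ξ i ≠ 0}.Subsingleton

/-- The left-length `sup ({0} ∪ {j + 1 | ξ j ≠ 0})` is at most `l`. -/
def LeftLengthLE {τ : ℂ} (ξ : ℤ → Ztau τ) (l : ℕ) : Prop := ∀ j : ℤ, ξ j ≠ 0 → j + 1 ≤ l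

/-- The `w`-NAFs of left-length at most `l` and arbitrary right-length. -/
def wNafLeft {τ : ℂ} (w : ℕ) (D : Set (Ztau τ)) (l : ℕ) : Set (ℤ → Ztau τ) :=
  {ξ | IsWNaf w D ξ ∧ LeftLengthLE ξ l}

/-- The `w`-NAFs of finite left-length and arbitrary right-length. -/
def wNafFinInf {τ : ℂ} (w : ℕ) (D : Set (Ztau τ)) : Set (ℤ → Ztau τ) :=
  {ξ | IsWNaf w D ξ ∧ ∃ l : ℕ, LeftLengthLE ξ l}

/-- The digits with non-negative index. -/
def integerPart {τ : ℂ} (ξ : ℤ → Ztau τ) : ℕ → Ztau τ := fun j => ξ (j : ℤ)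

/-- The series `∑ ξ_j τ^j` over all integers `j` converges (absolutely) to `z`. -/
def HasValue {τ : ℂ} (ξ : ℤ → Ztau τ) (z : ℂ) : Prop :=
  HasSum (fun j : ℤ => (ξ j : ℂ) * τ ^ j) z

/-- The fundamental domain: all values of `w`-NAFs that vanish left of the `τ`-point. -/
def fundamentalDomain (τ : ℂ) (w : ℕ) (D : Set (Ztau τ)) : Set ℂ :=
  {z | ∃ ξ ∈ wNafLeft w D 0, HasValue ξ z}

end WNaf

/-!
Write `F` for the fundamental domain and `q = |τ| ^ 2`. Looking at the digit of index `-1` of a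
`w`-NAF splits `F` into the pieces `τ⁻¹ F` (`zeroPiece`) and `η τ⁻¹ + τ ^ (-w) F` (`digitPiece`),
one for each non-zero digit `η`. Looking at the leading digit instead, a point has a `w`-NAF of
finite left-length with non-zero integer part if and only if it lies in `τ ^ (i + 1)` times one of
the pieces `η τ⁻¹ + τ ^ (-w) F` for some `i ≥ 0` (`exists_wNafFinInf_iff`). So the claim compares
the boundary of `F` with these scaled pieces.

Two facts about `F` are needed. It is compact (`isCompact_fundamentalDomain`), and it contains a
neighbourhood of `0` (`exists_ball_subset_fundamentalDomain`). The latter rests on the existence of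
a finite `w`-NAF for each element of `ℤ[τ]` (`exists_hasFiniteNaf`), proved by descent on the
absolute value: the digit `η` congruent to `x` modulo `τ ^ w` satisfies `|η| ≤ |x|`, whence
`|(x - η) / τ ^ w| ≤ 2 |x| / |τ| ^ w < |x|` except if `q = w = 2`, a case that is settled
separately. The same recursion bounds the length of the expansion in terms of `|x|`, and the
closedness of `F` does the rest.

Boundary points lie in scaled pieces: points outside `F` near a boundary point `z` have expansions
of bounded length, as multiples `τ ^ L F` exhaust the plane uniformly on bounded sets. Hence they
lie in a finite union of scaled pieces, which is closed and therefore contains `z`.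

Points of scaled pieces are not interior to `F`: there are at most `(q - 1) q ^ (w - 1)` non-zero
digits, so the measures of the pieces of `F` add up to at most
`(q⁻¹ + (q - 1) q ^ (w - 1) q ^ (-w)) vol F = vol F`. As the pieces cover `F`, two of them
can only overlap in a null set; this is used for `τ⁻¹ F` and one of the other pieces
(`volume_zeroPiece_inter_digitPiece`). If an interior point of `F` lay in a
scaled piece, then after division by a power of `τ` a neighbourhood of it would be contained in
`τ⁻¹ F` while it also lies in `η τ⁻¹ + τ ^ (-w) F`. The latter set has positive measure near each
of its points, a contradiction.
-/

namespace WNaf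

/-! ### The lattice `ℤ[τ]` -/

section Lattice

variable {τ : ℂ} {p q : ℤ}

lemma im_ne_zero_of_quadratic (hτ : τ ^ 2 - (p : ℂ) * τ + (q : ℂ) = 0)
    (hpq : 0 < 4 * q - p ^ 2) : τ.im ≠ 0 := by
  intro h
  have hre := congrArg Complex.re hτ
  simp [pow_two, h] at hre
  have hpq' : (0 : ℝ) < 4 * q - p ^ 2 := by exact_mod_cast hpq
  nlinarith [sq_nonneg (2 * τ.re - p)]

lemma re_eq_of_quadratic (hτ : τ ^ 2 - (p : ℂ) * τ + (q : ℂ) = 0)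
    (hpq : 0 < 4 * q - p ^ 2) : (p : ℝ) = 2 * τ.re := by
  have him := congrArg Complex.im hτ
  simp [pow_two] at him
  apply mul_right_cancel₀ (im_ne_zero_of_quadratic hτ hpq)
  linarith

lemma normSq_eq_of_quadratic (hτ : τ ^ 2 - (p : ℂ) * τ + (q : ℂ) = 0)
    (hpq : 0 < 4 * q - p ^ 2) : Complex.normSq τ = q := by
  have hre := congrArg Complex.re hτ
  simp [pow_two, re_eq_of_quadratic hτ hpq] at hre
  rw [Complex.normSq_apply]
  linarith

lemma norm_sq_eq_of_quadratic (hτ : τ ^ 2 - (p : ℂ) * τ + (q : ℂ) = 0)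
    (hpq : 0 < 4 * q - p ^ 2) : ‖τ‖ ^ 2 = q := by
  rw [← Complex.normSq_eq_norm_sq, normSq_eq_of_quadratic hτ hpq]

lemma two_le_of_one_lt_norm (hτ : τ ^ 2 - (p : ℂ) * τ + (q : ℂ) = 0)
    (hpq : 0 < 4 * q - p ^ 2) (h1 : 1 < ‖τ‖) : 2 ≤ q := by
  have h : (1 : ℝ) < q := by
    rw [← norm_sq_eq_of_quadratic hτ hpq]
    exact one_lt_pow₀ h1 two_ne_zero
  exact_mod_cast h

@[simp] lemma coe_base (τ : ℂ) : (base τ : ℂ) = τ := rfl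

lemma exists_int_add_int_mul_base (hτ : τ ^ 2 - (p : ℂ) * τ + (q : ℂ) = 0) (x : Ztau τ) :
    ∃ a b : ℤ, x = (a : Ztau τ) + (b : Ztau τ) * base τ := by
  obtain ⟨x, hx⟩ := x
  suffices h : ∃ a b : ℤ, x = (a : ℂ) + (b : ℂ) * τ by
    obtain ⟨a, b, h⟩ := h
    exact ⟨a, b, Subtype.ext (by simpa using h)⟩
  induction hx using Algebra.adjoin_induction with
  | mem x hx => exact ⟨0, 1, by simpa using hx⟩
  | algebraMap r => exact ⟨r, 0, by simp⟩
  | add x y _ _ hx hy =>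
    obtain ⟨a, b, rfl⟩ := hx
    obtain ⟨c, d, rfl⟩ := hy
    exact ⟨a + c, b + d, by push_cast; ring⟩
  | mul x y _ _ hx hy =>
    obtain ⟨a, b, rfl⟩ := hx
    obtain ⟨c, d, rfl⟩ := hy
    refine ⟨a * c - q * (b * d), a * d + b * c + p * (b * d), ?_⟩
    push_cast
    linear_combination ((b : ℂ) * d) * hτ

lemma norm_sq_int_add_int_mul (hτ : τ ^ 2 - (p : ℂ) * τ + (q : ℂ) = 0)
    (hpq : 0 < 4 * q - p ^ 2) (a b : ℤ) :
    ‖(a : ℂ) + (b : ℂ) * τ‖ ^ 2 = ((a ^ 2 + p * (a * b) + q * b ^ 2 : ℤ) : ℝ) := by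
  have h := normSq_eq_of_quadratic hτ hpq
  rw [Complex.normSq_apply] at h
  rw [← Complex.normSq_eq_norm_sq, Complex.normSq_apply]
  simp only [Complex.add_re, Complex.add_im, Complex.mul_re, Complex.mul_im, Complex.intCast_re,
    Complex.intCast_im]
  push_cast
  rw [re_eq_of_quadratic hτ hpq, ← h]
  ring

lemma exists_nat_norm_sq (hτ : τ ^ 2 - (p : ℂ) * τ + (q : ℂ) = 0)
    (hpq : 0 < 4 * q - p ^ 2) (x : Ztau τ) : ∃ n : ℕ, ‖(x : ℂ)‖ ^ 2 = n := by
  obtain ⟨a, b, rfl⟩ := exists_int_add_int_mul_base hτ x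
  have h := norm_sq_int_add_int_mul hτ hpq a b
  have h0 : 0 ≤ a ^ 2 + p * (a * b) + q * b ^ 2 := by
    have : (0 : ℝ) ≤ ((a ^ 2 + p * (a * b) + q * b ^ 2 : ℤ) : ℝ) := h ▸ sq_nonneg _
    exact_mod_cast this
  obtain ⟨n, hn⟩ := Int.eq_ofNat_of_zero_le h0
  refine ⟨n, ?_⟩
  push_cast [coe_base]
  rw [h, hn]
  simp

lemma finite_norm_le (hτ : τ ^ 2 - (p : ℂ) * τ + (q : ℂ) = 0)
    (hpq : 0 < 4 * q - p ^ 2) (R : ℝ) : {x : Ztau τ | ‖(x : ℂ)‖ ≤ R}.Finite := by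
  have him : 0 < |τ.im| := abs_pos.mpr (im_ne_zero_of_quadratic hτ hpq)
  set B : ℤ := ⌈R / |τ.im|⌉
  set K : ℤ := ⌈R + R / |τ.im| * ‖τ‖⌉
  refine Set.Finite.subset (((Set.finite_Icc (-K) K).prod (Set.finite_Icc (-B) B)).image
    (fun c : ℤ × ℤ => (c.1 : Ztau τ) + (c.2 : Ztau τ) * base τ)) ?_
  intro x hx
  obtain ⟨a, b, rfl⟩ := exists_int_add_int_mul_base hτ x
  simp only [Set.mem_ofPred_eq, Subalgebra.coe_add, Subalgebra.coe_mul, SubringClass.coe_intCast,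
    coe_base] at hx
  have hb : |(b : ℝ)| ≤ R / |τ.im| := by
    rw [le_div_iff₀ him, ← abs_mul]
    have := (Complex.abs_im_le_norm ((a : ℂ) + b * τ)).trans hx
    simpa using this
  have ha : |(a : ℝ)| ≤ R + R / |τ.im| * ‖τ‖ := by
    have h1 : ‖(a : ℂ)‖ ≤ ‖(a : ℂ) + b * τ‖ + ‖(b : ℂ) * τ‖ := by
      simpa using norm_sub_le ((a : ℂ) + b * τ) (b * τ)
    have h2 : ‖(b : ℂ) * τ‖ ≤ R / |τ.im| * ‖τ‖ := by
      rw [norm_mul, Complex.norm_intCast]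
      gcongr
    rw [Complex.norm_intCast] at h1
    linarith
  have hb' : |(b : ℝ)| ≤ (B : ℝ) := hb.trans (Int.le_ceil _)
  have ha' : |(a : ℝ)| ≤ (K : ℝ) := ha.trans (Int.le_ceil _)
  refine ⟨(a, b), ⟨?_, ?_⟩, rfl⟩
  · exact abs_le.mp (by exact_mod_cast ha')
  · exact abs_le.mp (by exact_mod_cast hb')

lemma exists_norm_sub_le (hτ : τ ^ 2 - (p : ℂ) * τ + (q : ℂ) = 0)
    (hpq : 0 < 4 * q - p ^ 2) (z : ℂ) : ∃ x : Ztau τ, ‖(x : ℂ) - z‖ ≤ 1 + |τ.im| := by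
  have him := im_ne_zero_of_quadratic hτ hpq
  set b : ℤ := ⌊z.im / τ.im⌋
  set a : ℤ := ⌊z.re - b * τ.re⌋
  refine ⟨(a : Ztau τ) + (b : Ztau τ) * base τ, (Complex.norm_le_abs_re_add_abs_im _).trans ?_⟩
  have ha1 := Int.floor_le (z.re - b * τ.re)
  have ha2 := (Int.lt_floor_add_one (z.re - b * τ.re)).le
  have hb1 := Int.floor_le (z.im / τ.im)
  have hb2 := (Int.lt_floor_add_one (z.im / τ.im)).le
  have h1 : |(a : ℝ) + b * τ.re - z.re| ≤ 1 := by
    rw [abs_le]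
    constructor <;> linarith
  have h2 : |b * τ.im - z.im| ≤ |τ.im| := by
    have : b * τ.im - z.im = (b - z.im / τ.im) * τ.im := by field_simp
    rw [this, abs_mul]
    refine mul_le_of_le_one_left (abs_nonneg _) ?_
    rw [abs_le]
    constructor <;> linarith
  simp only [Subalgebra.coe_add, Subalgebra.coe_mul, SubringClass.coe_intCast, coe_base,
    Complex.sub_re, Complex.sub_im, Complex.add_re, Complex.add_im, Complex.mul_re, Complex.mul_im,
    Complex.intCast_re, Complex.intCast_im, zero_mul, sub_zero, add_zero, zero_add]
  exact add_le_add h1 h2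

lemma base_sq (hτ : τ ^ 2 - (p : ℂ) * τ + (q : ℂ) = 0) :
    base τ ^ 2 = (p : Ztau τ) * base τ - (q : Ztau τ) :=
  Subtype.ext (by push_cast [coe_base]; linear_combination hτ)

lemma base_dvd_intCast (hτ : τ ^ 2 - (p : ℂ) * τ + (q : ℂ) = 0) : base τ ∣ (q : Ztau τ) :=
  ⟨(p : Ztau τ) - base τ, by linear_combination base_sq hτ⟩

lemma ne_zero_of_one_lt_norm (h1 : 1 < ‖τ‖) : τ ≠ 0 := by
  rintro rfl
  norm_num at h1

lemma base_ne_zero (h1 : 1 < ‖τ‖) : base τ ≠ 0 :=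
  fun h => ne_zero_of_one_lt_norm h1 (congrArg Subtype.val h)

/-- Every element of `ℤ[τ]` is congruent modulo `τ` to one of `0, …, q - 1`. -/
lemma exists_nat_base_dvd_sub (hτ : τ ^ 2 - (p : ℂ) * τ + (q : ℂ) = 0) (hq : 2 ≤ q)
    (x : Ztau τ) : ∃ d ∈ Finset.range q.toNat, base τ ∣ x - (d : Ztau τ) := by
  obtain ⟨a, b, rfl⟩ := exists_int_add_int_mul_base hτ x
  have hmod := Int.emod_nonneg a (by omega : q ≠ 0)
  have hlt := Int.emod_lt_of_pos a (by omega : 0 < q)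
  refine ⟨(a % q).toNat, Finset.mem_range.mpr (by omega), ?_⟩
  obtain ⟨c, hc⟩ := base_dvd_intCast hτ
  refine ⟨c * ((a / q : ℤ) : Ztau τ) + b, ?_⟩
  have h1 : (((a % q).toNat : ℕ) : Ztau τ) = ((a % q : ℤ) : Ztau τ) := by
    rw [← Int.cast_natCast, Int.toNat_of_nonneg hmod]
  have h2 : (a : Ztau τ) = (q : Ztau τ) * ((a / q : ℤ) : Ztau τ) + ((a % q : ℤ) : Ztau τ) := by
    exact_mod_cast congrArg (Int.cast : ℤ → Ztau τ) (Int.mul_ediv_add_emod a q).symm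
  rw [h1]
  linear_combination h2 + ((a / q : ℤ) : Ztau τ) * hc

lemma exists_finset_residues (hτ : τ ^ 2 - (p : ℂ) * τ + (q : ℂ) = 0) (hq : 2 ≤ q) (n : ℕ) :
    ∃ S : Finset (Ztau τ), S.card ≤ q.toNat ^ n ∧
      ∀ x : Ztau τ, ∃ s ∈ S, base τ ^ n ∣ x - s := by
  classical
  induction n with
  | zero => exact ⟨{0}, by simp, fun x => ⟨0, by simp⟩⟩
  | succ n ih =>
    obtain ⟨S, hS, h⟩ := ih
    refine ⟨Finset.image₂ (fun (d : ℕ) s => (d : Ztau τ) + base τ * s) (Finset.range q.toNat) S,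
      (Finset.card_image₂_le _ _ _).trans ?_, fun x => ?_⟩
    · rw [Finset.card_range, pow_succ']
      gcongr
    · obtain ⟨d, hd, y, hy⟩ := exists_nat_base_dvd_sub hτ hq x
      obtain ⟨s, hs, c, hc⟩ := h y
      refine ⟨_, Finset.mem_image₂_of_mem hd hs, c, ?_⟩
      linear_combination hy + base τ * hc

/-- The residue classes modulo `τ ^ (n + 1)` that are not divisible by `τ` have a system of
representatives of size at most `(q - 1) q ^ n`: the constant digit in base `τ` is non-zero. -/
lemma exists_finset_reduced_residues (hτ : τ ^ 2 - (p : ℂ) * τ + (q : ℂ) = 0) (hq : 2 ≤ q)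
    (n : ℕ) : ∃ S : Finset (Ztau τ), S.card ≤ (q.toNat - 1) * q.toNat ^ n ∧
      ∀ x : Ztau τ, ¬ base τ ∣ x → ∃ s ∈ S, base τ ^ (n + 1) ∣ x - s := by
  classical
  obtain ⟨S, hS, h⟩ := exists_finset_residues hτ hq n
  refine ⟨Finset.image₂ (fun (d : ℕ) s => (d : Ztau τ) + base τ * s)
    ((Finset.range q.toNat).erase 0) S, (Finset.card_image₂_le _ _ _).trans ?_, fun x hx => ?_⟩
  · rw [Finset.card_erase_of_mem (Finset.mem_range.mpr (by omega)), Finset.card_range]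
    gcongr
  · obtain ⟨d, hd, y, hy⟩ := exists_nat_base_dvd_sub hτ hq x
    obtain ⟨s, hs, c, hc⟩ := h y
    have hd0 : d ≠ 0 := by
      rintro rfl
      exact hx ⟨y, by simpa using hy⟩
    refine ⟨_, Finset.mem_image₂_of_mem (Finset.mem_erase.mpr ⟨hd0, hd⟩) hs, c, ?_⟩
    linear_combination hy + base τ * hc

end Lattice

/-! ### Digit sets -/

section Digits

variable {τ : ℂ} {p q : ℤ} {w : ℕ} {D : Set (Ztau τ)}

/-- The non-zero digits form a finite set; the bound on its size makes the measures of the pieces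
of the fundamental domain add up to no more than the measure of the whole. -/
lemma IsReducedResidueDigitSet.exists_card_le (hτ : τ ^ 2 - (p : ℂ) * τ + (q : ℂ) = 0)
    (hq : 2 ≤ q) (hw : 1 ≤ w) (hD : IsReducedResidueDigitSet τ w D) :
    ∃ E : Finset (Ztau τ), (∀ η, η ∈ E ↔ η ∈ D ∧ η ≠ 0) ∧
      E.card ≤ (q.toNat - 1) * q.toNat ^ (w - 1) := by
  classical
  obtain ⟨S, hS, h⟩ := exists_finset_reduced_residues hτ hq (w - 1)
  rw [Nat.sub_add_cancel hw] at h
  have h' : ∀ η ∈ D \ {0}, ∃ s ∈ S, base τ ^ w ∣ η - s :=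
    fun η hη => h η (hD.not_dvd η hη.1 hη.2)
  choose! f hfS hf using h'
  have hinj : Set.InjOn f (D \ {0}) := by
    intro η hη θ hθ hηθ
    refine (hD.existsUnique η (hD.not_dvd η hη.1 hη.2)).unique ⟨hη.1, by simp⟩ ⟨hθ.1, ?_⟩
    have := dvd_sub (hf η hη) (hf θ hθ)
    rwa [hηθ, sub_sub_sub_cancel_right] at this
  have hfin : (D \ {0}).Finite :=
    Set.Finite.of_finite_image (S.finite_toSet.subset (by rintro _ ⟨η, hη, rfl⟩; exact hfS η hη))
      hinj
  refine ⟨hfin.toFinset, fun η => by simp, ?_⟩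
  refine (Finset.card_le_card_of_injOn f (fun η hη => hfS η ?_) ?_).trans hS
  · simpa using hη
  · simpa using hinj

/-- A non-zero digit has minimal absolute value in its residue class modulo `τ ^ w`. -/
lemma IsMinNormDigitSet.norm_le (hD : IsMinNormDigitSet τ w D) {η x : Ztau τ}
    (hη : η ∈ D) (h : base τ ^ w ∣ x - η) : ‖(η : ℂ)‖ ≤ ‖(x : ℂ)‖ := by
  by_cases h0 : η = 0
  · simp [h0]
  obtain ⟨-, v, hv, hvη⟩ := hD.minNorm η hη h0
  obtain ⟨y, hy⟩ := h
  have hx : (x : ℂ) = τ ^ w * (v - ((-y : Ztau τ) : ℂ)) := by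
    have := congrArg (Subtype.val) hy
    push_cast [coe_base] at this ⊢
    simp only at hvη
    linear_combination this - hvη
  rw [hx, ← hvη]
  simp only [norm_mul]
  exact mul_le_mul_of_nonneg_left (hv _) (norm_nonneg _)

end Digits

/-! ### Operations on digit sequences -/

section Sequences

variable {τ : ℂ} {w : ℕ} {D : Set (Ztau τ)} {ξ : ℤ → Ztau τ}

lemma isWNaf_iff : IsWNaf w D ξ ↔
    (∀ j, ξ j ∈ D) ∧ ∀ i j, i < j → ξ i ≠ 0 → ξ j ≠ 0 → i + w ≤ j := by
  constructor
  · rintro ⟨h1, h2⟩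
    refine ⟨h1, fun i j hij hi hj => ?_⟩
    by_contra! hlt
    have := @h2 i i ⟨⟨le_rfl, by omega⟩, hi⟩ j ⟨⟨hij.le, hlt⟩, hj⟩
    omega
  · rintro ⟨h1, h2⟩
    refine ⟨h1, fun k i hi j hj => ?_⟩
    obtain ⟨⟨hi1, hi2⟩, hi⟩ := hi
    obtain ⟨⟨hj1, hj2⟩, hj⟩ := hj
    rcases lt_trichotomy i j with h | h | h
    · have := h2 i j h hi hj
      omega
    · exact h
    · have := h2 j i h hj hi
      omega

lemma IsWNaf.shift (h : IsWNaf w D ξ) (k : ℤ) : IsWNaf w D (fun j => ξ (j + k)) := by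
  rw [isWNaf_iff] at h ⊢
  refine ⟨fun j => h.1 _, fun i j hij hi hj => ?_⟩
  have := h.2 _ _ (by omega : i + k < j + k) hi hj
  omega

/-- Overwriting a digit preserves the `w`-NAF condition if all other non-zero digits are at
distance at least `w`. -/
lemma IsWNaf.update (h : IsWNaf w D ξ) (k : ℤ) {η : Ztau τ} (hη : η ∈ D)
    (hk : η ≠ 0 → ∀ j, j ≠ k → ξ j ≠ 0 → j + w ≤ k ∨ k + w ≤ j) :
    IsWNaf w D (Function.update ξ k η) := by
  rw [isWNaf_iff] at h ⊢
  refine ⟨fun j => ?_, fun i j hij hi hj => ?_⟩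
  · by_cases hj : j = k
    · simpa [hj] using hη
    · simpa [Function.update_of_ne hj] using h.1 j
  · by_cases hik : i = k
    · subst hik
      have hji : j ≠ i := hij.ne'
      rw [Function.update_self] at hi
      rw [Function.update_of_ne hji] at hj
      rcases hk hi j hji hj with h' | h' <;> omega
    · rw [Function.update_of_ne hik] at hi
      by_cases hjk : j = k
      · subst hjk
        rw [Function.update_self] at hj
        rcases hk hj i hik hi with h' | h' <;> omega
      · rw [Function.update_of_ne hjk] at hj
        exact h.2 i j hij hi hj

lemma HasValue.shift {z : ℂ} (hτ0 : τ ≠ 0) (h : HasValue ξ z) (k : ℤ) :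
    HasValue (fun j => ξ (j + k)) (τ ^ (-k) * z) := by
  have h1 := ((Equiv.addRight k).hasSum_iff.mpr h).mul_left (τ ^ (-k))
  have h2 : (fun j => τ ^ (-k) * ((fun j : ℤ => (ξ j : ℂ) * τ ^ j) ∘ Equiv.addRight k) j) =
      fun j : ℤ => (ξ (j + k) : ℂ) * τ ^ j := by
    funext j
    simp only [Function.comp_apply, Equiv.coe_addRight]
    rw [mul_left_comm, ← zpow_add₀ hτ0]
    congr 2
    ring
  rwa [h2] at h1

lemma HasValue.update {z : ℂ} (h : HasValue ξ z) (k : ℤ) (η : Ztau τ) :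
    HasValue (Function.update ξ k η) (z + ((η : ℂ) - ξ k) * τ ^ k) := by
  have h1 := HasSum.update h k ((η : ℂ) * τ ^ k)
  have h2 : Function.update (fun j : ℤ => (ξ j : ℂ) * τ ^ j) k ((η : ℂ) * τ ^ k) =
      fun j : ℤ => ((Function.update ξ k η j : Ztau τ) : ℂ) * τ ^ j := by
    funext j
    by_cases hj : j = k
    · subst hj
      simp
    · simp [Function.update_of_ne hj]
  rw [h2] at h1
  have h3 : (η : ℂ) * τ ^ k - (ξ k : ℂ) * τ ^ k + z = z + ((η : ℂ) - ξ k) * τ ^ k := by ring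
  rwa [h3] at h1

lemma isWNaf_zero (h0 : 0 ∈ D) : IsWNaf w D (fun _ => 0) :=
  isWNaf_iff.mpr ⟨fun _ => h0, fun _ _ _ h => absurd rfl h⟩

lemma hasValue_zero : HasValue (fun _ => (0 : Ztau τ)) 0 := by
  simp [HasValue, hasSum_zero]

lemma leftLengthLE_zero_iff : LeftLengthLE ξ 0 ↔ ∀ j, ξ j ≠ 0 → j < 0 := by
  simp only [LeftLengthLE, Nat.cast_zero]
  exact forall₂_congr fun j _ => by omega

end Sequences

/-! ### Self-similarity of the fundamental domain -/

section SelfSimilarity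

variable {τ : ℂ} {w : ℕ} {D : Set (Ztau τ)}

/-- The values of the `w`-NAFs without digits of non-negative index whose digit of index `-1` is
`0`: the image of the fundamental domain under multiplication by `τ⁻¹`. -/
def zeroPiece (τ : ℂ) (w : ℕ) (D : Set (Ztau τ)) : Set ℂ :=
  (fun z => τ⁻¹ * z) '' fundamentalDomain τ w D

/-- The values of the `w`-NAFs without digits of non-negative index whose digit of index `-1` is
the non-zero digit `η`. The next `w - 1` digits then vanish, so this is a translate of the image
of the fundamental domain under multiplication by `τ ^ (-w)`. -/
def digitPiece (τ : ℂ) (w : ℕ) (D : Set (Ztau τ)) (η : Ztau τ) : Set ℂ :=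
  (fun z => (η : ℂ) * τ⁻¹ + τ⁻¹ ^ w * z) '' fundamentalDomain τ w D

lemma zeroPiece_subset (hτ0 : τ ≠ 0) : zeroPiece τ w D ⊆ fundamentalDomain τ w D := by
  rintro _ ⟨z, ⟨ξ, ⟨h1, h2⟩, h3⟩, rfl⟩
  rw [leftLengthLE_zero_iff] at h2
  refine ⟨_, ⟨h1.shift 1, leftLengthLE_zero_iff.mpr fun j hj => ?_⟩, ?_⟩
  · have := h2 _ hj
    omega
  · simpa using h3.shift hτ0 1

lemma exists_wNaf_of_mem_digitPiece (hτ0 : τ ≠ 0) (hw : 1 ≤ w) {η : Ztau τ} (hη : η ∈ D) {z : ℂ}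
    (hz : z ∈ digitPiece τ w D η) : ∃ ξ ∈ wNafLeft w D 0, ξ (-1) = η ∧ HasValue ξ z := by
  obtain ⟨z, ⟨ξ, ⟨h1, h2⟩, h3⟩, rfl⟩ := hz
  rw [leftLengthLE_zero_iff] at h2
  have hlt : ∀ j : ℤ, ξ (j + w) ≠ 0 → j + w < 0 := fun j hj => h2 _ hj
  have hz0 : ξ (-1 + w) = 0 := by
    by_contra h
    have := hlt _ h
    omega
  refine ⟨Function.update (fun j => ξ (j + w)) (-1) η, ⟨(h1.shift w).update (-1) hη ?_, ?_⟩,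
    by simp, ?_⟩
  · intro _ j _ hj
    have := hlt j hj
    omega
  · rw [leftLengthLE_zero_iff]
    intro j hj
    by_cases hj1 : j = -1
    · omega
    · rw [Function.update_of_ne hj1] at hj
      have := hlt j hj
      omega
  · convert (h3.shift hτ0 w).update (-1) η using 1
    simp [hz0]
    ring

lemma mem_digitPiece_of_wNaf (hτ0 : τ ≠ 0) {ξ : ℤ → Ztau τ} (hξ : ξ ∈ wNafLeft w D 0)
    (h0 : 0 ∈ D) (hne : ξ (-1) ≠ 0) {z : ℂ} (hz : HasValue ξ z) :
    z ∈ digitPiece τ w D (ξ (-1)) := by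
  obtain ⟨h1, h2⟩ := hξ
  rw [leftLengthLE_zero_iff] at h2
  have h3 := (hz.update (-1) 0).shift hτ0 (-w)
  refine ⟨_, ⟨_, ⟨(h1.update (-1) h0 (by simp)).shift (-w), ?_⟩, h3⟩, ?_⟩
  · rw [leftLengthLE_zero_iff]
    intro j hj
    by_cases hj1 : j + -(w : ℤ) = -1
    · simp [hj1] at hj
    · simp only [Function.update_of_ne hj1] at hj
      have h4 := h2 _ hj
      have := (isWNaf_iff.mp h1).2 _ (-1) (by omega) hj hne
      omega
  · have : τ ^ w ≠ 0 := pow_ne_zero _ hτ0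
    simp
    field_simp
    ring

lemma digitPiece_subset (hτ0 : τ ≠ 0) (hw : 1 ≤ w) {η : Ztau τ} (hη : η ∈ D) :
    digitPiece τ w D η ⊆ fundamentalDomain τ w D := by
  intro z hz
  obtain ⟨ξ, h1, -, h2⟩ := exists_wNaf_of_mem_digitPiece hτ0 hw hη hz
  exact ⟨ξ, h1, h2⟩

lemma mem_zeroPiece_or_digitPiece (hτ0 : τ ≠ 0) (h0 : 0 ∈ D) {z : ℂ}
    (hz : z ∈ fundamentalDomain τ w D) :
    z ∈ zeroPiece τ w D ∨ ∃ η ∈ D, η ≠ 0 ∧ z ∈ digitPiece τ w D η := by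
  obtain ⟨ξ, hξ, hz⟩ := hz
  by_cases hne : ξ (-1) = 0
  · refine Or.inl ⟨τ * z, ⟨fun j => ξ (j + -1), ⟨hξ.1.shift _, ?_⟩, ?_⟩, by field_simp⟩
    · have h2 := leftLengthLE_zero_iff.mp hξ.2
      rw [leftLengthLE_zero_iff]
      intro j hj
      have := h2 _ hj
      have : j ≠ 0 := by
        rintro rfl
        exact hj (by simpa using hne)
      omega
    · simpa using hz.shift hτ0 (-1)
  · exact Or.inr ⟨_, hξ.1.mem _, hne, mem_digitPiece_of_wNaf hτ0 hξ h0 hne hz⟩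

/-- The points with a `w`-NAF of finite left-length and non-zero integer part form the union of
the scaled pieces `τ ^ (i + 1) * digitPiece τ w D η`, where `η` is the leading digit and `i ≥ 0`
its index. -/
lemma exists_wNafFinInf_iff (hτ0 : τ ≠ 0) (hw : 1 ≤ w) (h0 : 0 ∈ D) (z : ℂ) :
    (∃ ξ ∈ wNafFinInf w D, integerPart ξ ≠ 0 ∧ HasValue ξ z) ↔
      ∃ i : ℕ, ∃ η ∈ D, η ≠ 0 ∧ τ⁻¹ ^ (i + 1) * z ∈ digitPiece τ w D η := by
  classical
  constructor
  · rintro ⟨ξ, ⟨h1, l, hl⟩, hne, hz⟩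
    obtain ⟨k, hk⟩ := Function.ne_iff.mp hne
    simp only [integerPart, Pi.zero_apply] at hk
    have hkl : k ≤ l := by
      have := hl _ hk
      omega
    set i := Nat.findGreatest (fun n : ℕ => ξ (n : ℤ) ≠ 0) l
    have hi0 : ξ (i : ℤ) ≠ 0 := Nat.findGreatest_spec (P := fun n : ℕ => ξ (n : ℤ) ≠ 0) hkl hk
    have hshift := hz.shift hτ0 (i + 1)
    have key := mem_digitPiece_of_wNaf (w := w) (D := D) (ξ := fun j => ξ (j + (i + 1))) hτ0
      ⟨h1.shift _, ?_⟩ h0 (by simpa using hi0) hshift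
    · refine ⟨i, ξ i, h1.mem _, hi0, ?_⟩
      have hpow : τ⁻¹ ^ (i + 1) = τ ^ (-((i : ℤ) + 1)) := by
        rw [inv_pow, ← zpow_natCast, ← zpow_neg]
        norm_cast
      have hidx : (-1 + ((i : ℤ) + 1)) = i := by ring
      rw [hidx] at key
      rwa [hpow]
    · rw [leftLengthLE_zero_iff]
      intro j hj
      by_contra! hj0
      have hjl := hl _ hj
      have h2 : (i + 1 + j.toNat : ℕ) ≤ i :=
        Nat.le_findGreatest (P := fun n : ℕ => ξ (n : ℤ) ≠ 0) (by omega) (by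
          convert hj using 2
          push_cast
          omega)
      omega
  · rintro ⟨i, η, hη, hne, hz⟩
    obtain ⟨ξ, ⟨h1, h2⟩, h3, h4⟩ := exists_wNaf_of_mem_digitPiece hτ0 hw hη hz
    rw [leftLengthLE_zero_iff] at h2
    refine ⟨fun j => ξ (j + -(i + 1 : ℕ)), ⟨h1.shift _, i + 1, fun j hj => ?_⟩, ?_, ?_⟩
    · have := h2 _ hj
      omega
    · refine Function.ne_iff.mpr ⟨i, ?_⟩
      simp only [integerPart, Pi.zero_apply]
      convert hne using 1
      rw [← h3]
      congr 1
      push_cast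
      ring
    · convert h4.shift hτ0 _ using 1
      have : τ ^ (i + 1) ≠ 0 := pow_ne_zero _ hτ0
      rw [neg_neg, zpow_natCast, inv_pow]
      field_simp

end SelfSimilarity

/-! ### Compactness of the fundamental domain -/

section Compactness

variable {τ : ℂ} {w : ℕ} {D : Set (Ztau τ)}

lemma summable_norm_pow_of_neg (h1 : 1 < ‖τ‖) (M : ℝ) :
    Summable (fun j : ℤ => if j < 0 then M * ‖τ‖ ^ j else 0) := by
  have h0 : 0 < ‖τ‖ := one_pos.trans h1
  refine Summable.of_nat_of_neg_add_one ?_ ?_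
  · simp [show ∀ n : ℕ, ¬ ((n : ℤ) < 0) from fun n => by omega, summable_zero]
  · have hs := (summable_geometric_of_lt_one (by positivity) (inv_lt_one_of_one_lt₀ h1)).mul_left
      (M * ‖τ‖⁻¹)
    refine hs.congr fun n => ?_
    rw [if_pos (by omega), zpow_neg, ← inv_zpow, zpow_add₀ (by positivity)]
    simp only [zpow_natCast, zpow_one]
    ring

lemma isClosed_setOf_isWNaf (h : IsClosed D) : IsClosed {ξ : ℤ → Ztau τ | IsWNaf w D ξ} := by
  simp only [isWNaf_iff, Set.ofPred_and, Set.ofPred_forall]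
  refine (isClosed_iInter fun j => h.preimage (continuous_apply j)).inter ?_
  refine isClosed_iInter fun i => isClosed_iInter fun j => isClosed_iInter fun _ => ?_
  by_cases hij : i + w ≤ j
  · simp [hij]
  · have h0 : ∀ k : ℤ, IsClosed {ξ : ℤ → Ztau τ | ξ k = 0} := fun k =>
      isClosed_singleton.preimage (continuous_apply k)
    convert (h0 i).union (h0 j) using 1
    ext ξ
    simp [hij, or_iff_not_imp_left]

/-- The fundamental domain is the continuous image of a closed set of sequences in the compact
space `D ^ ℤ`. -/
theorem isCompact_fundamentalDomain (h1 : 1 < ‖τ‖) (hD : D.Finite) :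
    IsCompact (fundamentalDomain τ w D) := by
  obtain ⟨M, hM⟩ := (hD.image (fun x : Ztau τ => ‖(x : ℂ)‖)).bddAbove
  have hM' : ∀ η ∈ D, ‖(η : ℂ)‖ ≤ M := fun η hη => hM ⟨η, hη, rfl⟩
  set K : Set (ℤ → Ztau τ) := wNafLeft w D 0
  have hKc : IsCompact K := by
    refine (isCompact_univ_pi fun _ : ℤ => hD.isCompact).of_isClosed_subset ?_
      fun ξ hξ j _ => hξ.1.mem j
    refine (isClosed_setOf_isWNaf hD.isClosed).inter ?_
    change IsClosed {ξ : ℤ → Ztau τ | LeftLengthLE ξ 0}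
    simp only [leftLengthLE_zero_iff, Set.ofPred_forall]
    refine isClosed_iInter fun j => ?_
    by_cases hj : j < 0
    · simp [hj]
    · have h0 : IsClosed {ξ : ℤ → Ztau τ | ξ j = 0} :=
        isClosed_singleton.preimage (continuous_apply j)
      simpa [hj] using h0
  have hbound : ∀ j : ℤ, ∀ ξ ∈ K, ‖(ξ j : ℂ) * τ ^ j‖ ≤ if j < 0 then M * ‖τ‖ ^ j else 0 := by
    intro j ξ hξ
    split_ifs with hj
    · rw [norm_mul, norm_zpow]
      gcongr
      exact hM' _ (hξ.1.mem j)
    · have : ξ j = 0 := by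
        by_contra h
        exact hj (leftLengthLE_zero_iff.mp hξ.2 j h)
      simp [this]
  have hsum := summable_norm_pow_of_neg h1 M
  have hcont : ContinuousOn (fun ξ : ℤ → Ztau τ => ∑' j : ℤ, (ξ j : ℂ) * τ ^ j) K := by
    refine continuousOn_tsum (fun j => Continuous.continuousOn ?_) hsum hbound
    exact (continuous_subtype_val.comp (continuous_apply j)).mul continuous_const
  convert hKc.image_of_continuousOn hcont using 1
  ext z
  constructor
  · rintro ⟨ξ, hξ, hz⟩
    exact ⟨ξ, hξ, hz.tsum_eq⟩
  · rintro ⟨ξ, hξ, rfl⟩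
    exact ⟨ξ, hξ, (Summable.of_norm_bounded hsum fun j => hbound j ξ hξ).hasSum⟩

end Compactness

/-! ### Finite expansions of lattice elements -/

section Existence

variable {τ : ℂ} {p q : ℤ} {w : ℕ} {D : Set (Ztau τ)} {m n : ℕ} {x : Ztau τ}

/-- `x` is the value of a `w`-NAF whose non-zero digits all have index in `[0, n)`. -/
def HasFiniteNaf (w : ℕ) (D : Set (Ztau τ)) (n : ℕ) (x : Ztau τ) : Prop :=
  ∃ ξ : ℤ → Ztau τ, IsWNaf w D ξ ∧ (∀ j, ξ j ≠ 0 → 0 ≤ j ∧ j < n) ∧ HasValue ξ (x : ℂ)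

lemma HasFiniteNaf.mono (h : HasFiniteNaf w D m x) (hmn : m ≤ n) : HasFiniteNaf w D n x := by
  obtain ⟨ξ, h1, h2, h3⟩ := h
  refine ⟨ξ, h1, fun j hj => ?_, h3⟩
  have := h2 j hj
  omega

lemma HasFiniteNaf.zero (h0 : 0 ∈ D) : HasFiniteNaf w D 0 0 :=
  ⟨fun _ => 0, isWNaf_zero h0, fun _ h => absurd rfl h, by simpa using hasValue_zero⟩

lemma HasFiniteNaf.base_mul (hτ0 : τ ≠ 0) (h : HasFiniteNaf w D n x) :
    HasFiniteNaf w D (n + 1) (base τ * x) := by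
  obtain ⟨ξ, h1, h2, h3⟩ := h
  refine ⟨_, h1.shift (-1), fun j hj => ?_, ?_⟩
  · have := h2 _ hj
    omega
  · simpa using h3.shift hτ0 (-1)

lemma HasFiniteNaf.add_base_pow_mul (hτ0 : τ ≠ 0) (hw : 1 ≤ w) {η : Ztau τ} (hη : η ∈ D)
    (h : HasFiniteNaf w D n x) : HasFiniteNaf w D (n + w) (η + base τ ^ w * x) := by
  obtain ⟨ξ, h1, h2, h3⟩ := h
  have hz : ξ (0 + -w) = 0 := by
    by_contra hne
    have := h2 _ hne
    omega
  refine ⟨_, (h1.shift (-w)).update 0 hη ?_, fun j hj => ?_, ?_⟩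
  · intro _ j _ hj
    have := h2 _ hj
    omega
  · by_cases hj0 : j = 0
    · omega
    · rw [Function.update_of_ne hj0] at hj
      have := h2 _ hj
      omega
  · convert (h3.shift hτ0 (-w)).update 0 η using 1
    rw [hz]
    simp
    ring

lemma HasFiniteNaf.inv_pow_mul_mem (hτ0 : τ ≠ 0) (h : HasFiniteNaf w D n x) :
    τ⁻¹ ^ n * (x : ℂ) ∈ fundamentalDomain τ w D := by
  obtain ⟨ξ, h1, h2, h3⟩ := h
  refine ⟨_, ⟨h1.shift n, leftLengthLE_zero_iff.mpr fun j hj => ?_⟩, ?_⟩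
  · have := h2 _ hj
    omega
  · convert h3.shift hτ0 n using 1
    rw [zpow_neg, zpow_natCast, inv_pow]

/-- One step of the digit expansion of an element not divisible by `τ`. The bound `|η| ≤ |x|`
gives `|y| ≤ 2 |x| / |τ| ^ w`. -/
lemma IsMinNormDigitSet.exists_digit (hD : IsMinNormDigitSet τ w D) (hx : ¬ base τ ∣ x) :
    ∃ η ∈ D, ∃ y : Ztau τ, x = η + base τ ^ w * y ∧ ‖(η : ℂ)‖ ≤ ‖(x : ℂ)‖ ∧
      ‖τ‖ ^ w * ‖(y : ℂ)‖ = ‖(x : ℂ) - η‖ := by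
  obtain ⟨η, ⟨hη, hdvd⟩, -⟩ := hD.existsUnique x hx
  obtain ⟨y, hy⟩ := id hdvd
  refine ⟨η, hη, y, by linear_combination hy, hD.norm_le hη hdvd, ?_⟩
  have := congrArg Subtype.val hy
  push_cast [coe_base] at this
  rw [this, norm_mul, norm_pow]

/-- In the only case where `|τ| ^ w > 2` fails, namely `q = w = 2`, an element `x` that does not
get shorter by subtracting its digit and dividing by `τ ^ 2` is the negative of a digit and is
replaced by `2 x / τ ^ 2`. If this happened for `x` and its successors, then, as
`(2 / τ ^ 2) ^ k = -1` for some `k` when `p` is even, one of them would be a digit itself;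
for odd `p` already `2 x / τ ^ 2` is not in `ℤ[τ]`. -/
lemma not_forall_neg_mem_of_two {P : Ztau τ → Prop}
    (hτ : τ ^ 2 - (p : ℂ) * τ + ((2 : ℤ) : ℂ) = 0) (hp : 0 < 4 * 2 - p ^ 2) (hτ0 : base τ ≠ 0)
    (hP : ∀ x, P x → x ∉ D ∧ -x ∈ D ∧ ¬ base τ ∣ x ∧ ∃ y, P y ∧ base τ ^ 2 * y = 2 * x)
    (x : Ztau τ) : ¬ P x := by
  intro hx
  obtain ⟨-, hx1, hx2, y, hy, hxy⟩ := hP x hx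
  obtain ⟨hy1, -, -, z, hz, hyz⟩ := hP y hy
  obtain ⟨hz1, -⟩ := hP z hz
  have hsq : base τ ^ 2 = (p : Ztau τ) * base τ - 2 := by
    simpa using base_sq hτ
  have h2 : (2 : Ztau τ) ≠ 0 := two_ne_zero
  have hp2 : p < 3 := by nlinarith
  have hp3 : -3 < p := by nlinarith
  -- The case of odd `p`, where `e = p = ±1` is a unit.
  have hodd : ∀ e : Ztau τ, e * e = 1 → (p : Ztau τ) ≠ e := by
    intro e he hpe
    have h3 : base τ * y = (p : Ztau τ) * x - base τ * x := by
      apply mul_left_cancel₀ hτ0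
      linear_combination hxy + x * hsq
    refine hx2 ⟨e * (y + x), ?_⟩
    rw [hpe] at h3
    linear_combination -e * h3 - x * he
  -- The case `p = ±2`, where `τ ^ 4 = -4`, so that two steps lead from `x` to `-x`.
  have heven : ∀ e : Ztau τ, e * e = 4 → (p : Ztau τ) ≠ e := by
    intro e he hpe
    rw [hpe] at hsq
    have h4 : base τ ^ 4 = -4 := by
      linear_combination (base τ ^ 2 + e * base τ - 2 + e * e) * hsq +
        (-2 + base τ * e) * he
    have h5 : z = -x := by
      apply mul_left_cancel₀ (mul_ne_zero h2 h2)
      linear_combination -base τ ^ 2 * hyz - 2 * hxy + z * h4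
    exact hz1 (h5 ▸ hx1)
  interval_cases p
  · exact heven (-2) (by norm_num) (by norm_num)
  · exact hodd (-1) (by norm_num) (by norm_num)
  · have h5 : y = -x := by
      apply mul_left_cancel₀ h2
      rw [Int.cast_zero] at hsq
      linear_combination y * hsq - hxy
    exact hy1 (h5 ▸ hx1)
  · exact hodd 1 (by norm_num) (by norm_num)
  · exact heven 2 (by norm_num) (by norm_num)

/-- Every element of `ℤ[τ]` has a finite `w`-NAF. A counterexample `x` of minimal absolute value
is not divisible by `τ`; as its digit `η` satisfies `|η| ≤ |x|`, the element `(x - η) / τ ^ w`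
has absolute value at most `2 |x| / |τ| ^ w`, which is less than `|x|` unless `q = w = 2`. -/
theorem exists_hasFiniteNaf (hτ : τ ^ 2 - (p : ℂ) * τ + (q : ℂ) = 0)
    (hpq : 0 < 4 * q - p ^ 2) (h1 : 1 < ‖τ‖) (hw : 2 ≤ w) (hD : IsMinNormDigitSet τ w D)
    (x : Ztau τ) : ∃ n, HasFiniteNaf w D n x := by
  have hb0 := base_ne_zero h1
  have hτ0 := ne_zero_of_one_lt_norm h1
  have hq := two_le_of_one_lt_norm hτ hpq h1
  have hqR : (2 : ℝ) ≤ q := by exact_mod_cast hq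
  have hnq := norm_sq_eq_of_quadratic hτ hpq
  obtain ⟨N, hN⟩ := exists_nat_norm_sq hτ hpq x
  induction N using Nat.strong_induction_on generalizing x with
  | _ N ih =>
    have ih' : ∀ y : Ztau τ, ‖(y : ℂ)‖ ^ 2 < N → ∃ n, HasFiniteNaf w D n y := by
      intro y hy
      obtain ⟨k, hk⟩ := exists_nat_norm_sq hτ hpq y
      exact ih k (by rw [hk] at hy; exact_mod_cast hy) y hk
    have hdigit : ∀ η ∈ D, ∃ n, HasFiniteNaf w D n η := fun η hη =>
      ⟨_, by simpa using
        (HasFiniteNaf.zero (w := w) hD.zero_mem).add_base_pow_mul hτ0 (by omega) hη⟩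
    -- A further counterexample arises from each counterexample `y` of absolute value `√N` by
    -- splitting off its digit, and by minimality it is not shorter than `y`.
    have hstep : ∀ y : Ztau τ, ‖(y : ℂ)‖ ^ 2 = N → (¬ ∃ n, HasFiniteNaf w D n y) →
        ¬ base τ ∣ y ∧ ∃ η ∈ D, ∃ y' : Ztau τ, (¬ ∃ n, HasFiniteNaf w D n y') ∧
          y = η + base τ ^ w * y' ∧ ‖(η : ℂ)‖ ≤ ‖(y : ℂ)‖ ∧
          ‖τ‖ ^ w * ‖(y' : ℂ)‖ = ‖(y : ℂ) - η‖ ∧ ‖(y : ℂ)‖ ≤ ‖(y' : ℂ)‖ ∧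
          0 < ‖(y : ℂ)‖ := by
      intro y hy hbad
      have hy0 : 0 < ‖(y : ℂ)‖ := by
        rw [norm_pos_iff]
        intro h
        have hy0 : y = 0 := Subtype.ext h
        exact hbad ⟨0, hy0 ▸ HasFiniteNaf.zero hD.zero_mem⟩
      have hdvd : ¬ base τ ∣ y := by
        rintro ⟨c, rfl⟩
        have hc : ‖(c : ℂ)‖ ^ 2 < N := by
          rw [← hy]
          simp only [Subalgebra.coe_mul, coe_base, norm_mul] at hy0 ⊢
          have : 0 < ‖(c : ℂ)‖ := pos_of_mul_pos_right hy0 (norm_nonneg _)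
          gcongr
          nlinarith
        obtain ⟨n, hn⟩ := ih' c hc
        exact hbad ⟨_, hn.base_mul hτ0⟩
      obtain ⟨η, hη, y', h2, h3, h4⟩ := hD.exists_digit hdvd
      have hbad' : ¬ ∃ n, HasFiniteNaf w D n y' := by
        rintro ⟨n, hn⟩
        exact hbad ⟨_, h2 ▸ hn.add_base_pow_mul hτ0 (by omega) hη⟩
      refine ⟨hdvd, η, hη, y', hbad', h2, h3, h4, ?_, hy0⟩
      by_contra! hlt
      refine hbad' (ih' y' ?_)
      rw [← hy]
      gcongr
    by_contra hbad
    -- A counterexample forces `|τ| ^ w ≤ 2`.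
    have hTle : ‖τ‖ ^ w ≤ 2 := by
      obtain ⟨-, η, -, y', -, -, h3, h4, h5, h6⟩ := hstep x hN hbad
      have h7 := norm_sub_le (x : ℂ) η
      by_contra! hlt
      nlinarith
    have hTeq : ‖τ‖ ^ w = ‖τ‖ ^ 2 * ‖τ‖ ^ (w - 2) := by
      rw [← pow_add]
      congr 1
      omega
    have hone : 1 ≤ ‖τ‖ ^ (w - 2) := one_le_pow₀ h1.le
    have hq2 : q = 2 := by
      have : (q : ℝ) ≤ 2 := by nlinarith
      have : q ≤ 2 := by exact_mod_cast this
      omega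
    have hw2 : w = 2 := by
      by_contra hne
      have : 1 < ‖τ‖ ^ (w - 2) := one_lt_pow₀ h1 (by omega)
      nlinarith
    subst hq2 hw2
    refine not_forall_neg_mem_of_two (D := D)
      (P := fun y => ‖(y : ℂ)‖ ^ 2 = N ∧ ¬ ∃ n, HasFiniteNaf 2 D n y) hτ hpq hb0 ?_ x ⟨hN, hbad⟩
    rintro y ⟨hy, hybad⟩
    obtain ⟨h2, η, hη, y', h3, h4, h5, h6, h7, -⟩ := hstep y hy hybad
    -- Equality holds in the triangle inequality for `y - η`, with `|η| ≤ |y|`, so `η = -y`.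
    have hpar := parallelogram_law_with_norm ℝ (y : ℂ) (η : ℂ)
    rw [hnq] at h6
    push_cast at h6
    have hη0 := norm_nonneg (η : ℂ)
    have hy0 := norm_nonneg (y : ℂ)
    have hsum : ‖(y : ℂ) + η‖ = 0 := by
      have : ‖(y : ℂ) + η‖ * ‖(y : ℂ) + η‖ ≤ 0 := by
        rw [← h6] at hpar
        nlinarith
      exact mul_self_eq_zero.mp (le_antisymm this (mul_self_nonneg _))
    have hηy : η = -y := by
      apply Subtype.ext
      have := norm_eq_zero.mp hsum
      push_cast
      linear_combination this
    subst hηy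
    refine ⟨fun h => hybad (hdigit y h), hη, h2, y', ⟨?_, h3⟩, by linear_combination -h4⟩
    have h8 := norm_sub_le (y : ℂ) ((-y : Ztau τ) : ℂ)
    have h9 : ‖(y' : ℂ)‖ = ‖(y : ℂ)‖ := by linarith
    rw [h9, hy]

/-- The length of a finite `w`-NAF of `x` exceeds `log |x| / log |τ|` by at most a constant. The
additive constant `M` absorbs the digit subtracted in each step. -/
lemma exists_forall_hasFiniteNaf (hτ : τ ^ 2 - (p : ℂ) * τ + (q : ℂ) = 0)
    (hpq : 0 < 4 * q - p ^ 2) (h1 : 1 < ‖τ‖) (hw : 2 ≤ w) (hD : IsMinNormDigitSet τ w D)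
    {M : ℝ} (hM : ∀ η ∈ D, ‖(η : ℂ)‖ ≤ M) :
    ∃ C : ℕ, ∀ (n : ℕ) (x : Ztau τ), ‖(x : ℂ)‖ ≤ ‖τ‖ ^ n + M → HasFiniteNaf w D (n + C) x := by
  have hτ0 := ne_zero_of_one_lt_norm h1
  have hM0 : 0 ≤ M := by simpa using hM 0 hD.zero_mem
  have hq := two_le_of_one_lt_norm hτ hpq h1
  have hqR : (2 : ℝ) ≤ q := by exact_mod_cast hq
  have hnq := norm_sq_eq_of_quadratic hτ hpq
  have hT : 2 ≤ ‖τ‖ ^ w := by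
    rw [← hnq] at hqR
    exact hqR.trans (pow_le_pow_right₀ h1.le hw)
  choose f hf using exists_hasFiniteNaf hτ hpq h1 hw hD
  obtain ⟨C, hC⟩ := ((finite_norm_le hτ hpq (‖τ‖ ^ w + M)).image f).bddAbove
  refine ⟨C, fun n => ?_⟩
  induction n using Nat.strong_induction_on with
  | _ n ih =>
    intro x hx
    by_cases hn : n < w
    · refine (hf x).mono ((hC ⟨x, ?_, rfl⟩).trans (by omega))
      refine hx.trans ?_
      gcongr
      exact h1.le
    push Not at hn
    by_cases hdvd : base τ ∣ x
    · obtain ⟨c, rfl⟩ := hdvd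
      obtain ⟨m, rfl⟩ : ∃ m, n = m + 1 := ⟨n - 1, by omega⟩
      have hc : ‖(c : ℂ)‖ ≤ ‖τ‖ ^ m + M := by
        simp only [Subalgebra.coe_mul, coe_base, norm_mul] at hx
        refine le_of_mul_le_mul_left (hx.trans ?_) (one_pos.trans h1)
        rw [mul_add, ← pow_succ']
        nlinarith
      exact ((ih m (by omega) c hc).base_mul hτ0).mono (by omega)
    · obtain ⟨η, hη, y, rfl, -, h4⟩ := hD.exists_digit hdvd
      obtain ⟨m, rfl⟩ : ∃ m, n = m + w := ⟨n - w, by omega⟩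
      have hy : ‖(y : ℂ)‖ ≤ ‖τ‖ ^ m + M := by
        refine le_of_mul_le_mul_left (a := ‖τ‖ ^ w) ?_ (by linarith)
        have h5 := norm_sub_le ((η + base τ ^ w * y : Ztau τ) : ℂ) η
        have h6 := hM η hη
        rw [h4, mul_add, ← pow_add, add_comm w m]
        nlinarith
      exact ((ih m (by omega) y hy).add_base_pow_mul hτ0 (by omega) hη).mono (by omega)

/-- The origin is an interior point of the fundamental domain: the finite `w`-NAFs of length
`n + C`, divided by `τ ^ (n + C)`, become dense in a disc as `n` grows. -/
lemma exists_ball_subset_fundamentalDomain (hτ : τ ^ 2 - (p : ℂ) * τ + (q : ℂ) = 0)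
    (hpq : 0 < 4 * q - p ^ 2) (h1 : 1 < ‖τ‖) (hw : 2 ≤ w) (hD : IsMinNormDigitSet τ w D)
    (hfin : D.Finite) : ∃ δ > 0, Metric.ball 0 δ ⊆ fundamentalDomain τ w D := by
  have hτ0 := ne_zero_of_one_lt_norm h1
  obtain ⟨M, hM⟩ := (hfin.image (fun x : Ztau τ => ‖(x : ℂ)‖)).bddAbove
  have hM' : ∀ η ∈ D, ‖(η : ℂ)‖ ≤ max M (1 + |τ.im|) :=
    fun η hη => (hM ⟨η, hη, rfl⟩).trans (le_max_left _ _)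
  obtain ⟨C, hC⟩ := exists_forall_hasFiniteNaf hτ hpq h1 hw hD hM'
  have hpos : 0 < ‖τ‖ := one_pos.trans h1
  refine ⟨(‖τ‖ ^ C)⁻¹, by positivity, fun z hz => ?_⟩
  rw [mem_ball_zero_iff] at hz
  have hz' : ‖τ ^ C * z‖ ≤ 1 := by
    rw [norm_mul, norm_pow]
    exact (mul_lt_mul_of_pos_left hz (by positivity)).le.trans_eq
      (mul_inv_cancel₀ (by positivity))
  choose x hx using fun n : ℕ => exists_norm_sub_le hτ hpq (τ ^ n * (τ ^ C * z))
  have hmem : ∀ n, τ⁻¹ ^ (n + C) * (x n : ℂ) ∈ fundamentalDomain τ w D := by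
    intro n
    refine (hC n (x n) ?_).inv_pow_mul_mem hτ0
    have h2 := norm_le_norm_add_norm_sub' (x n : ℂ) (τ ^ n * (τ ^ C * z))
    have h3 : ‖τ ^ n * (τ ^ C * z)‖ ≤ ‖τ‖ ^ n := by
      rw [norm_mul, norm_pow]
      exact mul_le_of_le_one_right (by positivity) hz'
    have h4 := le_max_right M (1 + |τ.im|)
    have h5 := hx n
    linarith
  refine (isCompact_fundamentalDomain h1 hfin).isClosed.mem_of_tendsto ?_
    (Filter.Eventually.of_forall (f := Filter.atTop) hmem)
  rw [tendsto_iff_norm_sub_tendsto_zero]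
  have hlim : Filter.Tendsto (fun n : ℕ => (‖τ‖⁻¹) ^ (n + C) * (1 + |τ.im|)) Filter.atTop
      (nhds 0) := by
    have h2 := tendsto_pow_atTop_nhds_zero_of_lt_one (inv_nonneg.mpr hpos.le)
      (inv_lt_one_of_one_lt₀ h1)
    simpa using ((Filter.tendsto_add_atTop_iff_nat C).mpr h2).mul_const (1 + |τ.im|)
  refine squeeze_zero (fun _ => norm_nonneg _) (fun n => ?_) hlim
  have h2 : τ⁻¹ ^ (n + C) * (x n : ℂ) - z =
      τ⁻¹ ^ (n + C) * ((x n : ℂ) - τ ^ n * (τ ^ C * z)) := by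
    rw [mul_sub, ← mul_assoc, ← mul_assoc, mul_assoc (τ⁻¹ ^ (n + C)), ← pow_add, ← mul_pow,
      inv_mul_cancel₀ hτ0, one_pow, one_mul]
  rw [h2, norm_mul, norm_pow, norm_inv]
  gcongr
  exact hx n

end Existence

/-! ### Measure of the pieces -/

open MeasureTheory

section Measure

variable {τ : ℂ} {p q : ℤ} {w : ℕ} {D : Set (Ztau τ)}

lemma volume_image_affine (a c : ℂ) (s : Set ℂ) :
    volume ((fun z => a + c * z) '' s) = ENNReal.ofReal (‖c‖ ^ 2) * volume s := by
  have h1 : (fun z => a + c * z) '' s = (fun z => a + z) '' (LinearMap.mulLeft ℝ c '' s) := by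
    rw [Set.image_image]
    rfl
  have hdet : LinearMap.det (LinearMap.mulLeft ℝ c) = ‖c‖ ^ 2 := by
    rw [← Complex.normSq_eq_norm_sq]
    have h2 := Algebra.norm_apply ℝ c
    rw [Algebra.norm_complex_apply] at h2
    exact h2.symm
  rw [h1, Set.image_add_left, measure_preimage_add, Measure.addHaar_image_linearMap, hdet,
    abs_of_nonneg (sq_nonneg _)]

lemma isCompact_zeroPiece (hF : IsCompact (fundamentalDomain τ w D)) :
    IsCompact (zeroPiece τ w D) := hF.image (by fun_prop)

lemma isCompact_digitPiece (hF : IsCompact (fundamentalDomain τ w D)) (η : Ztau τ) :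
    IsCompact (digitPiece τ w D η) := hF.image (by fun_prop)

/-- The measures of the pieces of the fundamental domain add up to at most the measure of the
whole, since `q⁻¹ + (q - 1) q ^ (w - 1) * q ^ (-w) = 1`. As the pieces cover the whole, no
two of them overlap in a set of positive measure. -/
theorem volume_zeroPiece_inter_digitPiece (hτ : τ ^ 2 - (p : ℂ) * τ + (q : ℂ) = 0)
    (hpq : 0 < 4 * q - p ^ 2) (h1 : 1 < ‖τ‖) (hw : 1 ≤ w)
    (hD : IsReducedResidueDigitSet τ w D) (hF : IsCompact (fundamentalDomain τ w D))
    {η : Ztau τ} (hη : η ∈ D) (hne : η ≠ 0) :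
    volume (zeroPiece τ w D ∩ digitPiece τ w D η) = 0 := by
  classical
  have hτ0 := ne_zero_of_one_lt_norm h1
  have hq := two_le_of_one_lt_norm hτ hpq h1
  have hnq := norm_sq_eq_of_quadratic hτ hpq
  obtain ⟨E, hE, hcard⟩ := hD.exists_card_le hτ hq hw
  have hηE : η ∈ E := (hE η).mpr ⟨hη, hne⟩
  obtain ⟨v, hv⟩ : ∃ v : ℝ, 0 ≤ v ∧ volume (fundamentalDomain τ w D) = ENNReal.ofReal v :=
    ⟨_, ENNReal.toReal_nonneg, (ENNReal.ofReal_toReal hF.measure_lt_top.ne).symm⟩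
  obtain ⟨hv0, hv⟩ := hv
  have hA : volume (zeroPiece τ w D) = ENNReal.ofReal ((q : ℝ)⁻¹ * v) := by
    have h2 := volume_image_affine 0 τ⁻¹ (fundamentalDomain τ w D)
    simp only [zero_add, norm_inv, inv_pow] at h2
    rw [zeroPiece, h2, hnq, hv, ENNReal.ofReal_mul (by positivity)]
  have hB : ∀ θ : Ztau τ,
      volume (digitPiece τ w D θ) = ENNReal.ofReal ((q : ℝ)⁻¹ ^ w * v) := by
    intro θ
    rw [digitPiece, volume_image_affine, hv, norm_pow, ← pow_mul, mul_comm w 2, pow_mul, norm_inv,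
      inv_pow, hnq, ENNReal.ofReal_mul (by positivity)]
  have hqR : (2 : ℝ) ≤ q := by exact_mod_cast hq
  have hcover : fundamentalDomain τ w D ⊆ (zeroPiece τ w D ∪ digitPiece τ w D η) ∪
      ⋃ θ ∈ E.erase η, digitPiece τ w D θ := by
    intro z hz
    rcases mem_zeroPiece_or_digitPiece hτ0 hD.zero_mem hz with h | ⟨θ, hθ, hθ0, h⟩
    · exact Or.inl (Or.inl h)
    · by_cases hθη : θ = η
      · exact Or.inl (Or.inr (hθη ▸ h))
      · refine Or.inr (Set.mem_biUnion (x := θ) ?_ h)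
        exact Finset.mem_coe.mpr (Finset.mem_erase.mpr ⟨hθη, (hE θ).mpr ⟨hθ, hθ0⟩⟩)
  have hle : volume (fundamentalDomain τ w D) ≤
      volume (zeroPiece τ w D ∪ digitPiece τ w D η) +
        ENNReal.ofReal (((E.card : ℝ) - 1) * ((q : ℝ)⁻¹ ^ w * v)) := by
    refine (measure_mono hcover).trans ((measure_union_le _ _).trans ?_)
    gcongr
    refine (measure_biUnion_finset_le _ _).trans_eq ?_
    simp only [hB, Finset.sum_const, Finset.card_erase_of_mem hηE]
    have hpos : 1 ≤ E.card := Finset.card_pos.mpr ⟨η, hηE⟩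
    have hsub : (E.card : ℝ) - 1 = ((E.card - 1 : ℕ) : ℝ) := by
      rw [Nat.cast_sub hpos, Nat.cast_one]
    rw [nsmul_eq_mul, hsub, ENNReal.ofReal_mul (Nat.cast_nonneg _), ENNReal.ofReal_natCast]
  have hinc := measure_union_add_inter (μ := volume) (zeroPiece τ w D)
    (isCompact_digitPiece hF η).isClosed.measurableSet
  rw [hA, hB] at hinc
  have hfinU : volume (zeroPiece τ w D ∪ digitPiece τ w D η) ≠ ⊤ :=
    ((isCompact_zeroPiece hF).union (isCompact_digitPiece hF η)).measure_lt_top.ne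
  have hfinI : volume (zeroPiece τ w D ∩ digitPiece τ w D η) ≠ ⊤ :=
    ((measure_mono Set.inter_subset_left).trans_lt (isCompact_zeroPiece hF).measure_lt_top).ne
  have hcardR : (E.card : ℝ) ≤ ((q : ℝ) - 1) * (q : ℝ) ^ (w - 1) := by
    have h2 : ((q.toNat : ℕ) : ℝ) = q := by
      rw [← Int.cast_natCast, Int.toNat_of_nonneg (by omega)]
    have h3 : (E.card : ℝ) ≤ (((q.toNat - 1) * q.toNat ^ (w - 1) : ℕ) : ℝ) := by
      exact_mod_cast hcard
    rwa [Nat.cast_mul, Nat.cast_sub (by omega), Nat.cast_pow, h2, Nat.cast_one] at h3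
  -- From here on the computation takes place in `ℝ`.
  have hpos : (1 : ℝ) ≤ E.card := by exact_mod_cast Finset.card_pos.mpr ⟨η, hηE⟩
  have hinc' := congrArg ENNReal.toReal hinc
  rw [ENNReal.toReal_add hfinU hfinI, ENNReal.toReal_add ENNReal.ofReal_ne_top
    ENNReal.ofReal_ne_top, ENNReal.toReal_ofReal (by positivity),
    ENNReal.toReal_ofReal (by positivity)] at hinc'
  have hrest : 0 ≤ ((E.card : ℝ) - 1) * ((q : ℝ)⁻¹ ^ w * v) :=
    mul_nonneg (by linarith) (by positivity)
  have hle' := ENNReal.toReal_mono (ENNReal.add_ne_top.mpr ⟨hfinU, ENNReal.ofReal_ne_top⟩) hle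
  rw [hv, ENNReal.toReal_add hfinU ENNReal.ofReal_ne_top, ENNReal.toReal_ofReal hv0,
    ENNReal.toReal_ofReal hrest] at hle'
  have hqw : (q : ℝ)⁻¹ ^ w * (((q : ℝ) - 1) * (q : ℝ) ^ (w - 1)) = 1 - (q : ℝ)⁻¹ := by
    obtain ⟨m, rfl⟩ : ∃ m, w = m + 1 := ⟨w - 1, by omega⟩
    have hq0 : (q : ℝ) ≠ 0 := by positivity
    simp only [Nat.add_sub_cancel, pow_succ, inv_pow]
    field_simp
  have hmul : (E.card : ℝ) * ((q : ℝ)⁻¹ ^ w * v) ≤ (1 - (q : ℝ)⁻¹) * v := by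
    rw [← hqw]
    have := mul_le_mul_of_nonneg_right hcardR (by positivity : 0 ≤ (q : ℝ)⁻¹ ^ w * v)
    linarith
  have hzero : (volume (zeroPiece τ w D ∩ digitPiece τ w D η)).toReal ≤ 0 := by linarith
  exact ((ENNReal.toReal_eq_zero_iff _).mp
    (le_antisymm hzero ENNReal.toReal_nonneg)).resolve_right hfinI

lemma inv_pow_mul_mem_fundamentalDomain (hτ0 : τ ≠ 0) (i : ℕ) {z : ℂ}
    (hz : z ∈ fundamentalDomain τ w D) : τ⁻¹ ^ i * z ∈ fundamentalDomain τ w D := by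
  induction i with
  | zero => simpa
  | succ i ih =>
    rw [pow_succ', mul_assoc]
    exact zeroPiece_subset hτ0 ⟨_, ih, rfl⟩

/-- Each point of the fundamental domain lies in arbitrarily small affine copies of the
fundamental domain that are contained in it: fix a long initial part of a `w`-NAF of the point. -/
lemma exists_affine_copy (hτ0 : τ ≠ 0) (hw : 1 ≤ w) (h0 : 0 ∈ D) (k : ℕ) {z : ℂ}
    (hz : z ∈ fundamentalDomain τ w D) :
    ∃ (c : ℂ) (m : ℕ), k ≤ m ∧ z ∈ (fun y => c + τ⁻¹ ^ m * y) '' fundamentalDomain τ w D ∧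
      (fun y => c + τ⁻¹ ^ m * y) '' fundamentalDomain τ w D ⊆ fundamentalDomain τ w D := by
  induction k generalizing z with
  | zero => exact ⟨0, 0, le_rfl, by simpa using hz, by simp⟩
  | succ k ih =>
    rcases mem_zeroPiece_or_digitPiece hτ0 h0 hz with ⟨y, hy, rfl⟩ | ⟨η, hη, -, y, hy, rfl⟩
    · obtain ⟨c, m, hm, ⟨u, hu, hyu⟩, hsub⟩ := ih hy
      simp only at hyu
      refine ⟨τ⁻¹ * c, m + 1, by omega, ⟨u, hu, ?_⟩, ?_⟩
      · simp only [← hyu]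
        ring
      · rintro _ ⟨t, ht, rfl⟩
        refine zeroPiece_subset hτ0 ⟨_, hsub ⟨t, ht, rfl⟩, ?_⟩
        simp only
        ring
    · obtain ⟨c, m, hm, ⟨u, hu, hyu⟩, hsub⟩ := ih hy
      simp only at hyu
      refine ⟨η * τ⁻¹ + τ⁻¹ ^ w * c, m + w, by omega, ⟨u, hu, ?_⟩, ?_⟩
      · simp only [← hyu]
        ring
      · rintro _ ⟨t, ht, rfl⟩
        refine digitPiece_subset hτ0 hw hη ⟨_, hsub ⟨t, ht, rfl⟩, ?_⟩
        simp only
        ring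

/-- The fundamental domain has positive measure near each of its points. -/
lemma volume_inter_ball_pos (h1 : 1 < ‖τ‖) (hw : 1 ≤ w) (h0 : 0 ∈ D)
    (hF : IsCompact (fundamentalDomain τ w D)) (hpos : 0 < volume (fundamentalDomain τ w D))
    {z : ℂ} (hz : z ∈ fundamentalDomain τ w D) {ε : ℝ} (hε : 0 < ε) :
    0 < volume (fundamentalDomain τ w D ∩ Metric.ball z ε) := by
  have hτ0 := ne_zero_of_one_lt_norm h1
  have hτpos : 0 < ‖τ‖ := one_pos.trans h1
  obtain ⟨R, hR⟩ := hF.isBounded.exists_norm_le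
  have hlim : Filter.Tendsto (fun n : ℕ => ‖τ‖⁻¹ ^ n * (2 * R)) Filter.atTop (nhds 0) := by
    simpa using (tendsto_pow_atTop_nhds_zero_of_lt_one (inv_nonneg.mpr hτpos.le)
      (inv_lt_one_of_one_lt₀ h1)).mul_const (2 * R)
  obtain ⟨k, hk⟩ := Filter.eventually_atTop.mp (hlim.eventually_lt_const hε)
  obtain ⟨c, m, hm, ⟨u, hu, rfl⟩, hsub⟩ := exists_affine_copy hτ0 hw h0 k hz
  refine lt_of_lt_of_le ?_ (measure_mono (Set.subset_inter hsub ?_))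
  · rw [volume_image_affine]
    refine ENNReal.mul_pos (ENNReal.ofReal_pos.mpr ?_).ne' hpos.ne'
    have : τ⁻¹ ^ m ≠ 0 := pow_ne_zero _ (inv_ne_zero hτ0)
    positivity
  · rintro _ ⟨t, ht, rfl⟩
    rw [mem_ball_iff_norm]
    simp only
    rw [add_sub_add_left_eq_sub, ← mul_sub, norm_mul, norm_pow, norm_inv]
    refine lt_of_le_of_lt ?_ (hk m hm)
    gcongr
    have h2 := norm_sub_le t u
    have h3 := hR t ht
    have h4 := hR u hu
    linarith

end Measure

/-! ### The boundary -/

section Boundary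

variable {τ : ℂ} {p q : ℤ} {w : ℕ} {D : Set (Ztau τ)}

/-- Removing leading zeros: if division by `τ ^ L` moves `y` into the fundamental domain, then
either `y` already lies in it or the leading non-zero digit has an index `i` with `0 ≤ i < L`. -/
lemma mem_or_exists_inv_pow_mul_mem_digitPiece (hτ0 : τ ≠ 0) (h0 : 0 ∈ D) {L : ℕ} {y : ℂ}
    (hy : τ⁻¹ ^ L * y ∈ fundamentalDomain τ w D) :
    y ∈ fundamentalDomain τ w D ∨
      ∃ i < L, ∃ η ∈ D, η ≠ 0 ∧ τ⁻¹ ^ (i + 1) * y ∈ digitPiece τ w D η := by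
  induction L with
  | zero => exact Or.inl (by simpa using hy)
  | succ L ih =>
    rcases mem_zeroPiece_or_digitPiece hτ0 h0 hy with ⟨u, hu, huy⟩ | ⟨η, hη, hne, h⟩
    · have : u = τ⁻¹ ^ L * y := by
        apply mul_left_cancel₀ (inv_ne_zero hτ0)
        simp only at huy
        rw [huy, pow_succ', mul_assoc]
      rcases ih (this ▸ hu) with h | ⟨i, hi, h⟩
      · exact Or.inl h
      · exact Or.inr ⟨i, by omega, h⟩
    · exact Or.inr ⟨L, by omega, η, hη, hne, h⟩

/-- Close to a boundary point there are points outside the fundamental domain; their leading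
digits have bounded non-negative index, so they lie in a finite union of closed sets. -/
lemma exists_mem_digitPiece_of_mem_frontier (h1 : 1 < ‖τ‖) (h0 : 0 ∈ D) (hfin : D.Finite)
    {δ : ℝ} (hδ : 0 < δ) (hball : Metric.ball 0 δ ⊆ fundamentalDomain τ w D) {z : ℂ}
    (hz : z ∈ frontier (fundamentalDomain τ w D)) :
    ∃ i : ℕ, ∃ η ∈ D, η ≠ 0 ∧ τ⁻¹ ^ (i + 1) * z ∈ digitPiece τ w D η := by
  have hτ0 := ne_zero_of_one_lt_norm h1
  have hF := isCompact_fundamentalDomain (w := w) h1 hfin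
  have hlim : Filter.Tendsto (fun n : ℕ => ‖τ‖⁻¹ ^ n * (‖z‖ + 1)) Filter.atTop (nhds 0) := by
    simpa using (tendsto_pow_atTop_nhds_zero_of_lt_one (inv_nonneg.mpr (norm_nonneg τ))
      (inv_lt_one_of_one_lt₀ h1)).mul_const (‖z‖ + 1)
  obtain ⟨L, hL⟩ := (hlim.eventually_lt_const hδ).exists
  set U : Set ℂ := ⋃ i ∈ Finset.range L, ⋃ η ∈ D \ {0},
    (fun y => τ⁻¹ ^ (i + 1) * y) ⁻¹' digitPiece τ w D η with hU
  have hUc : IsClosed U := by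
    refine (Finset.finite_toSet _).isClosed_biUnion fun i _ => ?_
    refine (hfin.subset Set.sdiff_subset).isClosed_biUnion fun η _ => ?_
    exact (isCompact_digitPiece hF η).isClosed.preimage (by fun_prop)
  have hzU : z ∈ U := by
    by_contra hzU
    rw [frontier_eq_closure_inter_closure] at hz
    obtain ⟨y, ⟨hyU, hyz⟩, hyF⟩ := mem_closure_iff_nhds.mp hz.2 _
      (Filter.inter_mem (hUc.isOpen_compl.mem_nhds hzU) (Metric.ball_mem_nhds z one_pos))
    have hy : τ⁻¹ ^ L * y ∈ fundamentalDomain τ w D := by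
      refine hball (mem_ball_zero_iff.mpr (lt_of_le_of_lt ?_ hL))
      rw [norm_mul, norm_pow, norm_inv]
      gcongr
      have h2 := norm_le_norm_add_norm_sub' y z
      have h3 := mem_ball_iff_norm.mp hyz
      linarith
    rcases mem_or_exists_inv_pow_mul_mem_digitPiece hτ0 h0 hy with h | ⟨i, hi, η, hη, hne, h⟩
    · exact hyF h
    · refine hyU (Set.mem_biUnion (Finset.mem_coe.mpr (Finset.mem_range.mpr hi)) ?_)
      exact Set.mem_biUnion ⟨hη, hne⟩ h
  simp only [hU, Set.mem_iUnion, Set.mem_preimage] at hzU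
  obtain ⟨i, -, η, ⟨hη, hne⟩, h⟩ := hzU
  exact ⟨i, η, hη, hne, h⟩

/-- If `z` were an interior point, a small copy of the fundamental domain near
`τ ^ (-(i + 1)) * z` would lie in two different pieces, whose intersection is a null set. -/
lemma notMem_interior_of_mem_digitPiece (h1 : 1 < ‖τ‖) (hw : 1 ≤ w) (h0 : 0 ∈ D)
    (hF : IsCompact (fundamentalDomain τ w D)) (hpos : 0 < volume (fundamentalDomain τ w D))
    {η : Ztau τ} (hnull : volume (zeroPiece τ w D ∩ digitPiece τ w D η) = 0) {i : ℕ} {z : ℂ}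
    (hz : τ⁻¹ ^ (i + 1) * z ∈ digitPiece τ w D η) :
    z ∉ interior (fundamentalDomain τ w D) := by
  intro hzint
  have hτ0 := ne_zero_of_one_lt_norm h1
  have hτpos : 0 < ‖τ‖ := one_pos.trans h1
  obtain ⟨ε, hε, hball⟩ := Metric.isOpen_iff.mp isOpen_interior z hzint
  obtain ⟨f, hf, hfz⟩ := hz
  simp only at hfz
  have hε' : 0 < ε * ‖τ‖ ^ w / ‖τ‖ ^ (i + 1) := by positivity
  have hvol := volume_inter_ball_pos h1 hw h0 hF hpos hf hε'
  have himg : 0 < volume ((fun t => (η : ℂ) * τ⁻¹ + τ⁻¹ ^ w * t) ''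
      (fundamentalDomain τ w D ∩ Metric.ball f (ε * ‖τ‖ ^ w / ‖τ‖ ^ (i + 1)))) := by
    rw [volume_image_affine]
    refine ENNReal.mul_pos (ENNReal.ofReal_pos.mpr ?_).ne' hvol.ne'
    have : τ⁻¹ ^ w ≠ 0 := pow_ne_zero _ (inv_ne_zero hτ0)
    positivity
  refine (himg.trans_le (measure_mono ?_)).ne' hnull
  rintro _ ⟨t, ⟨ht, htf⟩, rfl⟩
  refine ⟨?_, t, ht, rfl⟩
  have hpow : τ⁻¹ ^ (i + 1) * τ ^ (i + 1) = 1 := by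
    rw [← mul_pow, inv_mul_cancel₀ hτ0, one_pow]
  have hy : τ ^ (i + 1) * ((η : ℂ) * τ⁻¹ + τ⁻¹ ^ w * t) ∈ fundamentalDomain τ w D := by
    refine interior_subset (hball ?_)
    have h2 : τ ^ (i + 1) * ((η : ℂ) * τ⁻¹ + τ⁻¹ ^ w * t) - z =
        τ ^ (i + 1) * (τ⁻¹ ^ w * (t - f)) := by
      linear_combination τ ^ (i + 1) * hfz + z * hpow
    rw [mem_ball_iff_norm] at htf ⊢
    rw [h2, norm_mul, norm_mul, norm_pow, norm_pow, norm_inv]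
    rw [lt_div_iff₀ (by positivity)] at htf
    rw [inv_pow]
    field_simp
    linarith
  refine ⟨_, inv_pow_mul_mem_fundamentalDomain hτ0 i hy, ?_⟩
  simp only
  rw [← mul_assoc, ← pow_succ', ← mul_assoc, hpow, one_mul]

end Boundary

end WNaf

theorem mainTheorem7 (τ : ℂ) (p q : ℤ) (hτ : τ ^ 2 - (p : ℂ) * τ + (q : ℂ) = 0)
    (hpq : 0 < 4 * q - p ^ 2) (hτ_norm : 1 < ‖τ‖) (w : ℕ) (hw : 2 ≤ w)
    (D : Set (WNaf.Ztau τ)) (hD : WNaf.IsMinNormDigitSet τ w D)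
    (z : ℂ) (hz : z ∈ WNaf.fundamentalDomain τ w D) :
    z ∈ frontier (WNaf.fundamentalDomain τ w D) ↔
      ∃ ξ ∈ WNaf.wNafFinInf w D, WNaf.integerPart ξ ≠ 0 ∧ WNaf.HasValue ξ z := by
  have hτ0 := WNaf.ne_zero_of_one_lt_norm hτ_norm
  have hw1 : 1 ≤ w := by omega
  have h0 := hD.zero_mem
  have hfin : D.Finite := by
    obtain ⟨E, hE, -⟩ := hD.exists_card_le hτ (WNaf.two_le_of_one_lt_norm hτ hpq hτ_norm) hw1
    refine (E.finite_toSet.insert 0).subset fun η hη => ?_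
    by_cases hne : η = 0
    · exact Or.inl hne
    · exact Or.inr (Finset.mem_coe.mpr ((hE η).mpr ⟨hη, hne⟩))
  have hF := WNaf.isCompact_fundamentalDomain (w := w) hτ_norm hfin
  obtain ⟨δ, hδ, hball⟩ :=
    WNaf.exists_ball_subset_fundamentalDomain hτ hpq hτ_norm hw hD hfin
  rw [WNaf.exists_wNafFinInf_iff hτ0 hw1 h0]
  constructor
  · exact WNaf.exists_mem_digitPiece_of_mem_frontier hτ_norm h0 hfin hδ hball
  · rintro ⟨i, η, hη, hne, h⟩
    rw [hF.isClosed.frontier_eq]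
    refine ⟨hz, WNaf.notMem_interior_of_mem_digitPiece hτ_norm hw1 h0 hF ?_
      (WNaf.volume_zeroPiece_inter_digitPiece hτ hpq hτ_norm hw1 hD.toIsReducedResidueDigitSet hF
        hη hne) h⟩
    exact (Metric.measure_ball_pos MeasureTheory.volume 0 hδ).trans_le
      (MeasureTheory.measure_mono hball)
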